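/- Let $0<\rho<1$ and let $\alpha,h$ be real, with $h\neq 4(1+\rho^2)\left(m+\tfrac52\right)^2$ for all integers $m\ge 0$. Write $(x)_n=x(x+1)\cdots(x+n-1)$, let $\sqrt{\cdot}$ be the principal complex square root, and for $k\ge 0$ put $$\Delta_k^{\pm}=2k+\tfrac12\pm\sqrt{\frac{h}{4(1+\rho^2)}} ,\qquad \eta=(1+\rho^2)\,\xi,\qquad z=-\rho^2\xi^2 ,$$ $$w_k(i)=\frac{\left(i+2k+\frac{\alpha}{2}+1\right)\left(i+2k-\frac{\alpha}{2}+\frac12\right)}{\left(i+2k+\frac52\right)(i+2k+2)},\qquad r_k(j,i)=\frac{(\Delta_k^-)_i\,(\Delta_k^+)_i\,\left(2k+\frac32\right)_j(2k+1)_j}{(\Delta_k^-)_j\,(\Delta_k^+)_j\,\left(2k+\frac32\right)_i(2k+1)_i}.$$ (so $r_0(0,i)=\frac{(\Delta_0^-)_i(\Delta_0^+)_i}{(3/2)_i(1)_i}$). Define $$LS^R(\xi)=\xi^{1/2}\,g(\xi),\qquad g(\xi)=\sum_{n=0}^{\infty}Y_n(\eta)\,z^n,$$ $$Y_n(\eta)=\sum_{i_0=0}^{\infty}w_0(i_0)\,r_0(0,i_0)\sum_{i_1=i_0}^{\infty}w_1(i_1)\,r_1(i_0,i_1)\cdots\sum_{i_{n-1}=i_{n-2}}^{\infty}w_{n-1}(i_{n-1})\,r_{n-1}(i_{n-2},i_{n-1})\sum_{i_n=i_{n-1}}^{\infty}r_n(i_{n-1},i_n)\,\eta^{i_n},$$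 where $Y_0(\eta)=\sum_{i_0\ge0}r_0(0,i_0)\eta^{i_0}$ and $\xi^{1/2}$ is the principal branch. Let $D=\{\xi\in\mathbb C: |\eta|+|z|<1\}$, a disc about $0$. Then: 1. No factor $(\Delta_k^{\pm})_i$ with $k\ge1$, $i\ge0$ vanishes, so that all terms are defined, and for $\xi\in D$ all the nested sums and the sum over $n$ converge (absolutely). 2. $g$ is holomorphic in $D$ and $g(0)=1$; thus $LS^R$ belongs to the exponent $\tfrac12$ at $\xi=0$, with leading coefficient $1$. 3. $LS^R$ is holomorphic in $D\setminus(-\infty,0]$ and there $y=LS^R$ satisfies Lamé's equation $$\frac{d^2y}{d\xi^2}+\frac12\left(\frac1\xi+\frac1{\xi-1}+\frac1{\xi-\rho^{-2}}\right)\frac{dy}{d\xi}+\frac{-\alpha(\alpha+1)\xi+h\rho^{-2}}{4\xi(\xi-1)(\xi-\rho^{-2})}\,y=0 .$$ 4. With the Jacobi elliptic function $\mathrm{sn}(u,\rho)$, the function $y(u)=LS^R(\mathrm{sn}^2(u,\rho))$ is twice differentiable and satisfies Lamé's equation in Weierstrass's form $$\frac{d^2y}{du^2}=\left\{\alpha(\alpha+1)\rho^2\,\mathrm{sn}^2(u,\rho)-h\right\}y$$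 at every real $u$ with $\mathrm{sn}(u,\rho)\ne0$ and $\mathrm{sn}^2(u,\rho)\in D$. -/

import Mathlib

open scoped Real

noncomputable section

namespace Lame

/-- The incomplete elliptic integral of the first kind with modulus `ρ`. -/
def ellipticF (ρ φ : ℝ) : ℝ :=
  ∫ θ in (0 : ℝ)..φ, 1 / √(1 - ρ ^ 2 * Real.sin θ ^ 2)

/-- The Jacobi amplitude, the inverse function of `φ ↦ ellipticF ρ φ`
(a bijection of `ℝ` for `0 < ρ < 1`). -/
def am (ρ : ℝ) : ℝ → ℝ :=
  Function.invFun (ellipticF ρ)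

/-- The Jacobi elliptic function `sn(u, ρ)` of a real argument. -/
def sn (ρ u : ℝ) : ℝ :=
  Real.sin (am ρ u)

/-- The rising factorial `(x)_n = x (x + 1) ⋯ (x + n - 1)`. -/
def poch (x : ℂ) (n : ℕ) : ℂ :=
  (ascPochhammer ℂ n).eval x

/-- `√(h / (4 (1 + ρ²)))`, the principal square root; it is imaginary for `h < 0`. -/
def root (ρ h : ℝ) : ℂ :=
  ((h : ℂ) / (4 * (1 + (ρ : ℂ) ^ 2))) ^ (1 / 2 : ℂ)

/-- `Δ_k⁻ = 2k + 1/2 - √(h / (4 (1 + ρ²)))`. -/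
def deltaMinus (ρ h : ℝ) (k : ℕ) : ℂ :=
  2 * k + 1 / 2 - root ρ h

/-- `Δ_k⁺ = 2k + 1/2 + √(h / (4 (1 + ρ²)))`. -/
def deltaPlus (ρ h : ℝ) (k : ℕ) : ℂ :=
  2 * k + 1 / 2 + root ρ h

/-- The quotient of rising factorials at level `k`, with `i = i_k` and `j = i_{k-1}`.
For `k = 0` it is used with `j = 0`, where it is
`(Δ_0⁻)_i (Δ_0⁺)_i / ((3/2)_i (1)_i)`. -/
def ratio (ρ h : ℝ) (k j i : ℕ) : ℂ :=
  (poch (deltaMinus ρ h k) i * poch (deltaPlus ρ h k) i *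
      poch (2 * k + 3 / 2) j * poch (2 * k + 1) j) /
    (poch (deltaMinus ρ h k) j * poch (deltaPlus ρ h k) j *
      poch (2 * k + 3 / 2) i * poch (2 * k + 1) i)

/-- The rational factor at level `k`, with `i = i_k`. -/
def weight (α : ℝ) (k i : ℕ) : ℂ :=
  ((i + 2 * k + (α : ℂ) / 2 + 1) * (i + 2 * k - (α : ℂ) / 2 + 1 / 2)) /
    ((i + 2 * k + 5 / 2) * (i + 2 * k + 2))

/-- The summand, at the value `i` of the index `i_k`, of the sum over `i_k ≥ i_{k-1} = j` at
level `k` of the nested series, when `m` further sums (over `i_{k+1}, …, i_{k+m}`) are nested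
inside it. -/
def summand (ρ α h : ℝ) (η : ℂ) : (m k j i : ℕ) → ℂ
  | 0, k, j, i => ratio ρ h k j i * η ^ i
  | m + 1, k, j, i =>
      weight α k i * ratio ρ h k j i *
        ∑' i' : Set.Ici i, summand ρ α h η m (k + 1) i i'

/-- The factor of `z ^ n`: the `(n + 1)`-fold nested sum over `0 ≤ i_0 ≤ i_1 ≤ ⋯ ≤ i_n`. -/
def nested (ρ α h : ℝ) (η : ℂ) (n : ℕ) : ℂ :=
  ∑' i : Set.Ici (0 : ℕ), summand ρ α h η n 0 0 i

/-- `η = (1 + ρ²) ξ`. -/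
def eta (ρ : ℝ) (ξ : ℂ) : ℂ :=
  (1 + (ρ : ℂ) ^ 2) * ξ

/-- `z = -ρ² ξ²`. -/
def zeta (ρ : ℝ) (ξ : ℂ) : ℂ :=
  -(ρ : ℂ) ^ 2 * ξ ^ 2

/-- The series in braces, without the factor `ξ^{1/2}`. -/
def bracket (ρ α h : ℝ) (ξ : ℂ) : ℂ :=
  ∑' n : ℕ, nested ρ α h (eta ρ ξ) n * zeta ρ ξ ^ n

/-- The function of the second kind `LS^R(ρ, α, h; ξ)`, with the principal branch of
`ξ^{1/2}`. -/
def LS (ρ α h : ℝ) (ξ : ℂ) : ℂ :=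
  ξ ^ (1 / 2 : ℂ) * bracket ρ α h ξ

/-- The disc about `0` on which `|η| + |z| < 1`. -/
def disc (ρ : ℝ) : Set ℂ :=
  {ξ | ‖eta ρ ξ‖ + ‖zeta ρ ξ‖ < 1}

end Lame

end

/-!
In terms of `n = i_k + 2k`, the series `∑ Y_n(η) zⁿ` is the sum of the weights of all lattice paths
from `0` with single steps `n ↦ n + 1` and double steps `n ↦ n + 2`: the quotients `r_k` collect
the runs of single steps, the factors `w_k` are the double steps, and `Y_n zⁿ` is the contribution
of the paths with exactly `n` double steps. Grouping the same paths by end point instead gives a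
power series in `ξ` whose coefficients satisfy the three-term recurrence of Frobenius' method, and
in terms of the Euler operator `ξ d/dξ` this recurrence is Lamé's equation.

The step weights tend to `η` and `z`. Multiplying by a suitable weight `E n`, constant for large
`n`, makes them at most `x` and `y` everywhere, for any `x > |η|` and `y > |z|`; choosing
`x + y < 1` bounds all the sums by geometric series. Finally `ξ = sn²(u, ρ)` satisfies
`ξ'² = 4ξ(1 - ξ)(1 - ρ²ξ)`, which turns the equation in `ξ` into Weierstrass's form.
-/

noncomputable section

namespace Lame

open Filter Topology Finset

section LatticePaths

variable {R : Type*} [CommSemiring R]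

/-- The product `a N * a (N + 1) * ⋯ * a (N + i - 1)`: the weight of `i` consecutive single steps
`n ↦ n + 1`, each of weight `a n`, starting at `N`. -/
def pathProd (a : ℕ → R) (N i : ℕ) : R :=
  ∏ l ∈ range i, a (N + l)

/-- The total weight of the lattice paths from `N` (with any end point) that consist of single
steps `n ↦ n + 1` of weight `a n` and exactly `m` double steps `n ↦ n + 2` of weight `b n`,
grouped by the number of single steps before the first double step. -/
def levelSum [TopologicalSpace R] (a b : ℕ → R) : ℕ → ℕ → R
  | 0, N => ∑' i, pathProd a N i
  | m + 1, N => ∑' i, pathProd a N i * (b (N + i) * levelSum a b m (N + i + 2))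

/-- The total weight of all lattice paths from `N`, grouped by the number of double steps. -/
def pathSum [TopologicalSpace R] (a b : ℕ → R) (N : ℕ) : R :=
  ∑' m, levelSum a b m N

/-- The total weight of the lattice paths from `0` to `n`, given by the three-term recurrence that
removes the last step. -/
def pathSeq (a b : ℕ → R) : ℕ → R
  | 0 => 1
  | 1 => a 0
  | n + 2 => a (n + 1) * pathSeq a b (n + 1) + b n * pathSeq a b n

theorem pathProd_zero (a : ℕ → R) (N : ℕ) : pathProd a N 0 = 1 :=
  prod_range_zero _

theorem pathProd_succ (a : ℕ → R) (N i : ℕ) :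
    pathProd a N (i + 1) = pathProd a N i * a (N + i) :=
  prod_range_succ _ i

theorem pathProd_succ' (a : ℕ → R) (N i : ℕ) :
    pathProd a N (i + 1) = a N * pathProd a (N + 1) i := by
  rw [pathProd, prod_range_succ', mul_comm, pathProd, add_zero]
  simp only [add_assoc, add_comm 1]

theorem pathProd_mul_const (a : ℕ → R) (t : R) (N i : ℕ) :
    pathProd (fun n => a n * t) N i = pathProd a N i * t ^ i := by
  simp only [pathProd, prod_mul_distrib, prod_const, card_range]

theorem pathSeq_mul_pow (a b : ℕ → R) (t : R) (n : ℕ) :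
    pathSeq (fun n => a n * t) (fun n => b n * t ^ 2) n = pathSeq a b n * t ^ n := by
  induction n using Nat.twoStepInduction with
  | zero => simp only [pathSeq, pow_zero, mul_one]
  | one => simp only [pathSeq, pow_one]
  | more n ih₀ ih₁ =>
    simp only [pathSeq] at ih₀ ih₁ ⊢
    rw [ih₀, ih₁]
    ring

theorem eq_sum_pathSeq_add_remainder {a b P : ℕ → R}
    (hP : ∀ n, P n = 1 + a n * P (n + 1) + b n * P (n + 2)) (n : ℕ) :
    P 0 = ∑ i ∈ range (n + 1), pathSeq a b i +
      (pathSeq a b (n + 1) * P (n + 1) + pathSeq a b n * (b n * P (n + 2))) := by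
  induction n with
  | zero =>
    rw [hP 0]
    simp only [zero_add, sum_range_one, pathSeq]
    ring
  | succ n ih =>
    rw [ih, sum_range_succ _ (n + 1), hP (n + 1), pathSeq]
    ring

end LatticePaths

theorem levelSum_mul_right {𝕜 : Type*} [NormedField 𝕜] (a b : ℕ → 𝕜) (z : 𝕜) (m N : ℕ) :
    levelSum a (fun n => b n * z) m N = levelSum a b m N * z ^ m := by
  induction m generalizing N with
  | zero => rw [levelSum, levelSum, pow_zero, mul_one]
  | succ m ih =>
    rw [levelSum, levelSum, ← tsum_mul_right]
    refine tsum_congr fun i => ?_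
    rw [ih]
    ring

/-- A weight `E ≥ 1` relative to which the steps `a` and `b` of a lattice path have size at most
`x` and `y`. It turns bounds on the step weights that hold only asymptotically into bounds that
hold along every path. -/
structure IsMajorant {𝕜 : Type*} [NormedField 𝕜] (a b : ℕ → 𝕜) (x y : ℝ) (E : ℕ → ℝ) : Prop where
  one_le : ∀ n, 1 ≤ E n
  single : ∀ n, ‖a n‖ * E (n + 1) ≤ x * E n
  double : ∀ n, ‖b n‖ * E (n + 2) ≤ y * E n

section Majorant

variable {𝕜 : Type*} [NormedField 𝕜] {a b : ℕ → 𝕜} {x y : ℝ} {E : ℕ → ℝ}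

theorem exists_antitone_weight {c : ℕ → ℝ} (hc : ∀ n, 1 ≤ c n) (K : ℕ) :
    ∃ E : ℕ → ℝ, (∀ n, 1 ≤ E n) ∧ Antitone E ∧ (∀ n < K, E n = c n * E (n + 1)) ∧
      ∀ n ≥ K, E n = 1 := by
  set E : ℕ → ℝ := fun n => ∏ l ∈ Ico n K, c l with hE
  have one_le : ∀ n, 1 ≤ E n := fun n => Finset.one_le_prod fun l _ => hc l
  have of_lt : ∀ n < K, E n = c n * E (n + 1) := fun n hn => prod_eq_prod_Ico_succ_bot hn c
  have of_ge : ∀ n ≥ K, E n = 1 := fun n hn => by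
    simp only [hE, Ico_eq_empty_of_le hn, prod_empty]
  refine ⟨E, one_le, antitone_nat_of_succ_le fun n => ?_, of_lt, of_ge⟩
  rcases lt_or_ge n K with hn | hn
  · rw [of_lt n hn]
    exact le_mul_of_one_le_left (zero_le_one.trans (one_le _)) (hc n)
  · rw [of_ge n hn, of_ge (n + 1) (by omega)]

theorem exists_isMajorant_of_eventually_le (hx : 0 < x) (hy : 0 < y)
    (ha : ∀ᶠ n in atTop, ‖a n‖ ≤ x) (hb : ∀ᶠ n in atTop, ‖b n‖ ≤ y) :
    ∃ E, IsMajorant a b x y E := by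
  obtain ⟨K, hK⟩ := eventually_atTop.1 (ha.and hb)
  set c : ℕ → ℝ := fun n => 1 + ‖a n‖ / x + ‖b n‖ / y
  have ha_div : ∀ n, 0 ≤ ‖a n‖ / x := fun n => by positivity
  have hb_div : ∀ n, 0 ≤ ‖b n‖ / y := fun n => by positivity
  have hac : ∀ n, ‖a n‖ ≤ x * c n := fun n => by
    rw [← div_le_iff₀' hx]
    linarith [hb_div n]
  have hbc : ∀ n, ‖b n‖ ≤ y * c n := fun n => by
    rw [← div_le_iff₀' hy]
    linarith [ha_div n]
  obtain ⟨E, one_le, anti, of_lt, of_ge⟩ := exists_antitone_weight (c := c)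
    (fun n => by linarith [ha_div n, hb_div n]) K
  have step : ∀ (u : ℕ → 𝕜) (v : ℝ), (∀ n, ‖u n‖ ≤ v * c n) → (∀ n ≥ K, ‖u n‖ ≤ v) →
      ∀ n, ‖u n‖ * E (n + 1) ≤ v * E n := by
    intro u v hu hu' n
    rcases lt_or_ge n K with hn | hn
    · rw [of_lt n hn, ← mul_assoc]
      exact mul_le_mul_of_nonneg_right (hu n) (zero_le_one.trans (one_le _))
    · rw [of_ge n hn, of_ge (n + 1) (by omega), mul_one, mul_one]
      exact hu' n hn
  refine ⟨E, one_le, step a x hac fun n hn => (hK n hn).1, fun n => ?_⟩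
  calc ‖b n‖ * E (n + 2) ≤ ‖b n‖ * E (n + 1) :=
        mul_le_mul_of_nonneg_left (anti (n + 1).le_succ) (norm_nonneg _)
    _ ≤ y * E n := step b y hbc (fun n hn => (hK n hn).2) n

theorem exists_isMajorant_of_tendsto {η z : 𝕜} (ha : Tendsto a atTop (𝓝 η))
    (hb : Tendsto b atTop (𝓝 z)) (hx : ‖η‖ < x) (hy : ‖z‖ < y) :
    ∃ E, IsMajorant a b x y E :=
  exists_isMajorant_of_eventually_le ((norm_nonneg η).trans_lt hx) ((norm_nonneg z).trans_lt hy)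
    (ha.norm.eventually (eventually_le_nhds hx)) (hb.norm.eventually (eventually_le_nhds hy))

namespace IsMajorant

theorem pos (hE : IsMajorant a b x y E) (n : ℕ) : 0 < E n :=
  one_pos.trans_le (hE.one_le n)

theorem single_nonneg (hE : IsMajorant a b x y E) : 0 ≤ x :=
  nonneg_of_mul_nonneg_left
    ((mul_nonneg (norm_nonneg _) (hE.pos 1).le).trans (hE.single 0)) (hE.pos 0)

theorem double_nonneg (hE : IsMajorant a b x y E) : 0 ≤ y :=
  nonneg_of_mul_nonneg_left
    ((mul_nonneg (norm_nonneg _) (hE.pos 2).le).trans (hE.double 0)) (hE.pos 0)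

theorem norm_pathProd_mul_le (hE : IsMajorant a b x y E) (N i : ℕ) :
    ‖pathProd a N i‖ * E (N + i) ≤ x ^ i * E N := by
  induction i with
  | zero => rw [pathProd_zero, norm_one, pow_zero, add_zero]
  | succ i ih =>
    calc ‖pathProd a N (i + 1)‖ * E (N + (i + 1))
        = ‖pathProd a N i‖ * (‖a (N + i)‖ * E (N + i + 1)) := by
          rw [pathProd_succ, norm_mul, mul_assoc, add_assoc]
      _ ≤ ‖pathProd a N i‖ * (x * E (N + i)) :=
          mul_le_mul_of_nonneg_left (hE.single _) (norm_nonneg _)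
      _ = x * (‖pathProd a N i‖ * E (N + i)) := by ring
      _ ≤ x * (x ^ i * E N) := mul_le_mul_of_nonneg_left ih hE.single_nonneg
      _ = x ^ (i + 1) * E N := by ring

theorem norm_pathProd_le (hE : IsMajorant a b x y E) (N i : ℕ) :
    ‖pathProd a N i‖ ≤ E N * x ^ i := by
  rw [mul_comm]
  exact (le_mul_of_one_le_right (norm_nonneg _) (hE.one_le _)).trans
    (hE.norm_pathProd_mul_le N i)

theorem norm_pathProd_mul_double_le (hE : IsMajorant a b x y E) {B : ℝ} {t : ℕ → 𝕜}
    (ht : ∀ n, ‖t n‖ ≤ E n * B) (N i : ℕ) :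
    ‖pathProd a N i * (b (N + i) * t (N + i + 2))‖ ≤ E N * (y * B) * x ^ i := by
  have hB : 0 ≤ B := nonneg_of_mul_nonneg_right ((norm_nonneg _).trans (ht 0)) (hE.pos 0)
  have hy := hE.double_nonneg
  calc ‖pathProd a N i * (b (N + i) * t (N + i + 2))‖
      ≤ ‖pathProd a N i‖ * (‖b (N + i)‖ * (E (N + i + 2) * B)) := by
        rw [norm_mul, norm_mul]
        gcongr
        exact ht _
    _ = ‖pathProd a N i‖ * (‖b (N + i)‖ * E (N + i + 2)) * B := by ring
    _ ≤ ‖pathProd a N i‖ * (y * E (N + i)) * B := by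
        gcongr ‖pathProd a N i‖ * ?_ * B
        exact hE.double _
    _ = ‖pathProd a N i‖ * E (N + i) * (y * B) := by ring
    _ ≤ x ^ i * E N * (y * B) := by
        gcongr ?_ * (y * B)
        exact hE.norm_pathProd_mul_le N i
    _ = E N * (y * B) * x ^ i := by ring

theorem norm_levelSum_le (hE : IsMajorant a b x y E) (hx : x < 1) (m N : ℕ) :
    ‖levelSum a b m N‖ ≤ E N * ((y * (1 - x)⁻¹) ^ m * (1 - x)⁻¹) := by
  have geometric := hasSum_geometric_of_lt_one hE.single_nonneg hx
  induction m generalizing N with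
  | zero =>
    rw [levelSum, pow_zero, one_mul]
    exact tsum_of_norm_bounded (geometric.mul_left (E N)) (hE.norm_pathProd_le N)
  | succ m ih =>
    rw [levelSum]
    refine (tsum_of_norm_bounded (geometric.mul_left _)
      (hE.norm_pathProd_mul_double_le ih N)).trans_eq ?_
    ring

theorem hasSum_geometric_levelSum_bound (hE : IsMajorant a b x y E) (hxy : x + y < 1) (N : ℕ) :
    HasSum (fun m => E N * ((y * (1 - x)⁻¹) ^ m * (1 - x)⁻¹)) (E N * (1 - (x + y))⁻¹) := by
  have hy := hE.double_nonneg
  have hx : 0 < 1 - x := by linarith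
  have hquot : y * (1 - x)⁻¹ < 1 := by
    rw [← div_eq_mul_inv, div_lt_one hx]
    linarith
  have hsum : (1 - y * (1 - x)⁻¹)⁻¹ * (1 - x)⁻¹ = (1 - (x + y))⁻¹ := by
    rw [← mul_inv, sub_mul, one_mul, inv_mul_cancel_right₀ hx.ne', sub_sub]
  rw [← hsum]
  exact ((hasSum_geometric_of_lt_one (by positivity) hquot).mul_right _).mul_left (E N)

theorem norm_pathSum_le (hE : IsMajorant a b x y E) (hxy : x + y < 1) (N : ℕ) :
    ‖pathSum a b N‖ ≤ E N * (1 - (x + y))⁻¹ :=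
  tsum_of_norm_bounded (hE.hasSum_geometric_levelSum_bound hxy N)
    fun m => hE.norm_levelSum_le (by linarith [hE.double_nonneg]) m N

theorem norm_pathSeq_mul_le (hE : IsMajorant a b x y E) {θ : ℝ} (hxθ : x ≤ θ)
    (hyθ : x * θ + y ≤ θ ^ 2) (n : ℕ) : ‖pathSeq a b n‖ * E n ≤ E 0 * θ ^ n := by
  have hx := hE.single_nonneg
  have hy := hE.double_nonneg
  have hθ := hx.trans hxθ
  have hE₀ := (hE.pos 0).le
  induction n using Nat.twoStepInduction with
  | zero => rw [pathSeq, norm_one, one_mul, pow_zero, mul_one]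
  | one =>
    rw [pathSeq, pow_one, mul_comm (E 0)]
    exact (hE.single 0).trans (mul_le_mul_of_nonneg_right hxθ hE₀)
  | more n ih₀ ih₁ =>
    have hEn := (hE.pos (n + 2)).le
    calc ‖pathSeq a b (n + 2)‖ * E (n + 2)
        ≤ (‖a (n + 1)‖ * ‖pathSeq a b (n + 1)‖ + ‖b n‖ * ‖pathSeq a b n‖) * E (n + 2) := by
          rw [pathSeq, ← norm_mul, ← norm_mul]
          gcongr
          exact norm_add_le _ _
      _ = ‖pathSeq a b (n + 1)‖ * (‖a (n + 1)‖ * E (n + 2)) +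
            ‖pathSeq a b n‖ * (‖b n‖ * E (n + 2)) := by ring
      _ ≤ ‖pathSeq a b (n + 1)‖ * (x * E (n + 1)) + ‖pathSeq a b n‖ * (y * E n) := by
          gcongr ‖pathSeq a b (n + 1)‖ * ?_ + ‖pathSeq a b n‖ * ?_
          exacts [hE.single _, hE.double _]
      _ = x * (‖pathSeq a b (n + 1)‖ * E (n + 1)) + y * (‖pathSeq a b n‖ * E n) := by ring
      _ ≤ x * (E 0 * θ ^ (n + 1)) + y * (E 0 * θ ^ n) := by gcongr
      _ = E 0 * θ ^ n * (x * θ + y) := by ring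
      _ ≤ E 0 * θ ^ n * θ ^ 2 := by gcongr
      _ = E 0 * θ ^ (n + 2) := by ring

theorem norm_remainder_le (hE : IsMajorant a b x y E)
    (hxy : x + y < 1) {θ : ℝ} (hxθ : x ≤ θ) (hyθ : x * θ + y ≤ θ ^ 2) (n : ℕ) :
    ‖pathSeq a b (n + 1) * pathSum a b (n + 1) + pathSeq a b n * (b n * pathSum a b (n + 2))‖ ≤
      E 0 * (θ + y) * (1 - (x + y))⁻¹ * θ ^ n := by
  have hy := hE.double_nonneg
  have : 0 ≤ (1 - (x + y))⁻¹ := inv_nonneg.2 (by linarith)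
  have hs := hE.norm_pathSeq_mul_le hxθ hyθ
  have hP := hE.norm_pathSum_le hxy
  refine (norm_add_le _ _).trans ?_
  simp only [norm_mul]
  calc ‖pathSeq a b (n + 1)‖ * ‖pathSum a b (n + 1)‖ +
        ‖pathSeq a b n‖ * (‖b n‖ * ‖pathSum a b (n + 2)‖)
      ≤ ‖pathSeq a b (n + 1)‖ * (E (n + 1) * (1 - (x + y))⁻¹) +
          ‖pathSeq a b n‖ * (‖b n‖ * (E (n + 2) * (1 - (x + y))⁻¹)) := by
        gcongr
        exacts [hP _, hP _]
    _ = (‖pathSeq a b (n + 1)‖ * E (n + 1) +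
          ‖pathSeq a b n‖ * (‖b n‖ * E (n + 2))) * (1 - (x + y))⁻¹ := by ring
    _ ≤ (‖pathSeq a b (n + 1)‖ * E (n + 1) +
          ‖pathSeq a b n‖ * (y * E n)) * (1 - (x + y))⁻¹ := by
        gcongr (_ + ‖pathSeq a b n‖ * ?_) * _
        exact hE.double n
    _ = (‖pathSeq a b (n + 1)‖ * E (n + 1) +
          y * (‖pathSeq a b n‖ * E n)) * (1 - (x + y))⁻¹ := by ring
    _ ≤ (E 0 * θ ^ (n + 1) + y * (E 0 * θ ^ n)) * (1 - (x + y))⁻¹ := by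
        gcongr (?_ + y * ?_) * _
        exacts [hs _, hs _]
    _ = E 0 * (θ + y) * (1 - (x + y))⁻¹ * θ ^ n := by ring

variable [CompleteSpace 𝕜]

theorem summable_pathProd (hE : IsMajorant a b x y E) (hx : x < 1) (N : ℕ) :
    Summable fun i => pathProd a N i :=
  .of_norm_bounded ((summable_geometric_of_lt_one hE.single_nonneg hx).mul_left _)
    (hE.norm_pathProd_le N)

theorem summable_pathProd_mul_double (hE : IsMajorant a b x y E) (hx : x < 1) (m N : ℕ) :
    Summable fun i => pathProd a N i * (b (N + i) * levelSum a b m (N + i + 2)) :=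
  .of_norm_bounded ((summable_geometric_of_lt_one hE.single_nonneg hx).mul_left _)
    (hE.norm_pathProd_mul_double_le (hE.norm_levelSum_le hx m) N)

theorem levelSum_zero_eq (hE : IsMajorant a b x y E) (hx : x < 1) (N : ℕ) :
    levelSum a b 0 N = 1 + a N * levelSum a b 0 (N + 1) := by
  rw [levelSum, (hE.summable_pathProd hx N).tsum_eq_zero_add, levelSum, ← tsum_mul_left,
    pathProd_zero]
  simp only [pathProd_succ']

theorem levelSum_succ_eq (hE : IsMajorant a b x y E) (hx : x < 1) (m N : ℕ) :
    levelSum a b (m + 1) N =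
      a N * levelSum a b (m + 1) (N + 1) + b N * levelSum a b m (N + 2) := by
  rw [levelSum, (hE.summable_pathProd_mul_double hx m N).tsum_eq_zero_add, levelSum,
    ← tsum_mul_left, pathProd_zero, one_mul, add_zero, add_comm]
  simp only [pathProd_succ', mul_assoc, add_assoc, add_comm 1]

theorem summable_levelSum (hE : IsMajorant a b x y E) (hxy : x + y < 1) (N : ℕ) :
    Summable fun m => levelSum a b m N :=
  .of_norm_bounded (hE.hasSum_geometric_levelSum_bound hxy N).summable
    fun m => hE.norm_levelSum_le (by linarith [hE.double_nonneg]) m N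

theorem pathSum_eq (hE : IsMajorant a b x y E) (hxy : x + y < 1) (N : ℕ) :
    pathSum a b N = 1 + a N * pathSum a b (N + 1) + b N * pathSum a b (N + 2) := by
  have hx : x < 1 := by linarith [hE.double_nonneg]
  have summable := hE.summable_levelSum hxy
  have summable_tail := (summable_nat_add_iff 1).2 (summable (N + 1))
  calc pathSum a b N
      = levelSum a b 0 N + ∑' m, levelSum a b (m + 1) N := (summable N).tsum_eq_zero_add
    _ = 1 + a N * levelSum a b 0 (N + 1) +
          (a N * ∑' m, levelSum a b (m + 1) (N + 1) + b N * pathSum a b (N + 2)) := by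
        rw [hE.levelSum_zero_eq hx, tsum_congr fun m => hE.levelSum_succ_eq hx m N,
          (summable_tail.mul_left _).tsum_add ((summable _).mul_left _),
          tsum_mul_left, tsum_mul_left, pathSum]
    _ = 1 + a N * pathSum a b (N + 1) + b N * pathSum a b (N + 2) := by
        rw [pathSum.eq_def a b (N + 1), (summable (N + 1)).tsum_eq_zero_add]
        ring

theorem hasSum_pathSeq (hE : IsMajorant a b x y E)
    (hxy : x + y < 1) : HasSum (pathSeq a b) (pathSum a b 0) := by
  have hx := hE.single_nonneg
  have hy := hE.double_nonneg
  set θ := √(x + y) with hθ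
  have hθ₀ : 0 ≤ θ := Real.sqrt_nonneg _
  have hθ_sq : θ ^ 2 = x + y := Real.sq_sqrt (add_nonneg hx hy)
  have hθ₁ : θ < 1 := by rwa [hθ, Real.sqrt_lt' one_pos, one_pow]
  have hxθ : x ≤ θ := by nlinarith
  have hyθ : x * θ + y ≤ θ ^ 2 := by nlinarith
  have summable : Summable (pathSeq a b) :=
    .of_norm_bounded ((summable_geometric_of_lt_one hθ₀ hθ₁).mul_left (E 0)) fun n =>
      (le_mul_of_one_le_right (norm_nonneg _) (hE.one_le n)).trans
        (hE.norm_pathSeq_mul_le hxθ hyθ n)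
  have remainder_tendsto : Tendsto (fun n => pathSum a b 0 - ∑ i ∈ range (n + 1), pathSeq a b i)
      atTop (𝓝 0) := by
    refine squeeze_zero_norm (fun n => ?_) (by
      simpa only [mul_zero] using (tendsto_pow_atTop_nhds_zero_of_lt_one hθ₀ hθ₁).const_mul
        (E 0 * (θ + y) * (1 - (x + y))⁻¹))
    rw [eq_sum_pathSeq_add_remainder (hE.pathSum_eq hxy) n, add_sub_cancel_left]
    exact hE.norm_remainder_le hxy hxθ hyθ n
  have partial_sums : Tendsto (fun n => ∑ i ∈ range (n + 1), pathSeq a b i) atTop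
      (𝓝 (pathSum a b 0)) := by
    simpa only [sub_sub_cancel, sub_zero] using remainder_tendsto.const_sub (pathSum a b 0)
  rw [← tendsto_nhds_unique ((tendsto_add_atTop_iff_nat 1).2 summable.hasSum.tendsto_sum_nat)
    partial_sums]
  exact summable.hasSum

end IsMajorant

end Majorant

section Coefficients

/-- The condition on `h` under which no `Δ_k^±` with `k ≥ 1` is a nonpositive integer, so that the
nested series has no zero denominators. -/
def NonResonant (ρ h : ℝ) : Prop :=
  ∀ m : ℕ, h ≠ 4 * (1 + ρ ^ 2) * ((m : ℝ) + 5 / 2) ^ 2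

/-- The weight of the single step `n ↦ n + 1`, up to the factor `η`: the quotient of consecutive
values of `ratio ρ h k j i`, which depends on `k` and `i` only through `n = i + 2 * k`. -/
def singleCoeff (ρ h : ℝ) (n : ℕ) : ℂ :=
  ((n + (1 / 2 - root ρ h)) * (n + (1 / 2 + root ρ h))) / ((n + 3 / 2) * (n + 1))

/-- The weight of the double step `n ↦ n + 2`, up to the factor `z`: the value of `weight α k i`,
which depends on `k` and `i` only through `n = i + 2 * k`. -/
def doubleCoeff (α : ℝ) (n : ℕ) : ℂ :=
  ((n + ((α : ℂ) / 2 + 1)) * (n + (1 / 2 - (α : ℂ) / 2))) / ((n + 5 / 2) * (n + 2))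

/-- The Taylor coefficients of `bracket` at `0`. -/
def seriesCoeff (ρ α h : ℝ) : ℕ → ℂ :=
  pathSeq (fun n => singleCoeff ρ h n * (1 + (ρ : ℂ) ^ 2))
    (fun n => doubleCoeff α n * -(ρ : ℂ) ^ 2)

theorem tendsto_quadratic_div_quadratic (a b c d : ℂ) :
    Tendsto (fun n : ℕ => (((n : ℂ) + a) * (n + b)) / ((n + c) * (n + d))) atTop (𝓝 1) := by
  have linear (a c : ℂ) : Tendsto (fun n : ℕ => ((n : ℂ) + a) / (n + c)) atTop (𝓝 1) := by
    simpa only [one_mul, div_one, add_comm] using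
      tendsto_add_mul_div_add_mul_atTop_nhds a c 1 (one_ne_zero (α := ℂ))
  simpa only [div_mul_div_comm, one_mul] using (linear a c).mul (linear b d)

theorem tendsto_singleCoeff (ρ h : ℝ) : Tendsto (singleCoeff ρ h) atTop (𝓝 1) :=
  tendsto_quadratic_div_quadratic ..

theorem tendsto_doubleCoeff (α : ℝ) : Tendsto (doubleCoeff α) atTop (𝓝 1) :=
  tendsto_quadratic_div_quadratic ..

theorem exists_isMajorant_coeff (ρ α h : ℝ) {η z : ℂ} {x y : ℝ} (hx : ‖η‖ < x) (hy : ‖z‖ < y) :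
    ∃ E, IsMajorant (fun n => singleCoeff ρ h n * η) (fun n => doubleCoeff α n * z) x y E :=
  exists_isMajorant_of_tendsto
    (by simpa only [one_mul] using (tendsto_singleCoeff ρ h).mul_const η)
    (by simpa only [one_mul] using (tendsto_doubleCoeff α).mul_const z) hx hy

theorem one_add_ofReal_sq_ne_zero (ρ : ℝ) : 1 + (ρ : ℂ) ^ 2 ≠ 0 := by
  exact_mod_cast (by positivity : 1 + ρ ^ 2 ≠ 0)

theorem root_sq (ρ h : ℝ) : root ρ h ^ 2 = h / (4 * (1 + (ρ : ℂ) ^ 2)) := by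
  rw [root, one_div]
  exact Complex.cpow_ofNat_inv_pow _ 2

theorem poch_zero (x : ℂ) : poch x 0 = 1 := by
  rw [poch, ascPochhammer_zero, Polynomial.eval_one]

theorem poch_succ (x : ℂ) (n : ℕ) : poch x (n + 1) = poch x n * (x + n) :=
  ascPochhammer_succ_eval n x

theorem poch_ne_zero {x : ℂ} (hx : ∀ l : ℕ, x ≠ -l) (n : ℕ) : poch x n ≠ 0 := by
  rw [poch, Ne, ascPochhammer_eval_eq_zero_iff]
  rintro ⟨l, -, hl⟩
  exact hx l (by rw [hl, neg_neg])

theorem poch_ofReal_ne_zero {x : ℝ} (hx : 0 < x) (n : ℕ) : poch x n ≠ 0 := by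
  refine poch_ne_zero (fun l hl => ?_) n
  have : x = -l := by exact_mod_cast hl
  linarith [l.cast_nonneg (α := ℝ)]

namespace NonResonant

variable {ρ h : ℝ}

theorem root_sq_ne (hh : NonResonant ρ h) (m : ℕ) : root ρ h ^ 2 ≠ ((m : ℂ) + 5 / 2) ^ 2 := by
  intro hroot
  have hρ := one_add_ofReal_sq_ne_zero ρ
  refine hh m ?_
  rw [root_sq, div_eq_iff (by simpa using hρ)] at hroot
  have : (h : ℂ) = (4 * (1 + ρ ^ 2) * ((m : ℝ) + 5 / 2) ^ 2 : ℝ) := by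
    rw [hroot]
    push_cast
    ring
  exact_mod_cast this

theorem poch_deltaMinus_ne_zero (hh : NonResonant ρ h) {k : ℕ} (hk : 1 ≤ k) (i : ℕ) :
    poch (deltaMinus ρ h k) i ≠ 0 := by
  obtain ⟨k, rfl⟩ := Nat.exists_eq_add_of_le' hk
  refine poch_ne_zero (fun l hl => hh.root_sq_ne (2 * k + l) ?_) i
  rw [deltaMinus] at hl
  push_cast at hl ⊢
  rw [show root ρ h = 2 * k + l + 5 / 2 by linear_combination -hl]

theorem poch_deltaPlus_ne_zero (hh : NonResonant ρ h) {k : ℕ} (hk : 1 ≤ k) (i : ℕ) :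
    poch (deltaPlus ρ h k) i ≠ 0 := by
  obtain ⟨k, rfl⟩ := Nat.exists_eq_add_of_le' hk
  refine poch_ne_zero (fun l hl => hh.root_sq_ne (2 * k + l) ?_) i
  rw [deltaPlus] at hl
  push_cast at hl ⊢
  rw [show root ρ h = -(2 * k + l + 5 / 2) by linear_combination hl, neg_sq]

end NonResonant

theorem ratio_eq_pathProd {ρ h : ℝ} {k j : ℕ} (hminus : poch (deltaMinus ρ h k) j ≠ 0)
    (hplus : poch (deltaPlus ρ h k) j ≠ 0) (i : ℕ) :
    ratio ρ h k j (j + i) = pathProd (singleCoeff ρ h) (j + 2 * k) i := by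
  have hhalf : poch (2 * k + 3 / 2) j ≠ 0 := by
    simpa using poch_ofReal_ne_zero (by positivity : (0 : ℝ) < 2 * k + 3 / 2) j
  have hone : poch (2 * k + 1) j ≠ 0 := by
    simpa using poch_ofReal_ne_zero (by positivity : (0 : ℝ) < 2 * k + 1) j
  induction i with
  | zero =>
    rw [pathProd_zero, ratio, add_zero]
    exact div_self (by positivity)
  | succ i ih =>
    rw [pathProd_succ, ← ih, ← add_assoc, ratio, ratio, singleCoeff, div_mul_div_comm]
    simp only [poch_succ, deltaMinus, deltaPlus]
    push_cast
    congr 1 <;> ring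

theorem ratio_eq_zero {ρ h : ℝ} {k j : ℕ}
    (hj : poch (deltaMinus ρ h k) j = 0 ∨ poch (deltaPlus ρ h k) j = 0) (i : ℕ) :
    ratio ρ h k j i = 0 := by
  rw [ratio, mul_eq_zero.2 hj, zero_mul, zero_mul, div_zero]

theorem weight_eq_doubleCoeff (α : ℝ) (k i : ℕ) : weight α k i = doubleCoeff α (i + 2 * k) := by
  rw [weight, doubleCoeff]
  push_cast
  congr 1
  ring

end Coefficients

section NestedSums

/-- The shift `i ↦ j + i` as a bijection onto `[j, ∞)`. -/
def addEquivIci (j : ℕ) : ℕ ≃ Set.Ici j where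
  toFun i := ⟨j + i, j.le_add_right i⟩
  invFun i := i - j
  left_inv := j.add_sub_cancel_left
  right_inv i := Subtype.ext (Nat.add_sub_of_le i.2)

theorem tsum_Ici_eq {M : Type*} [AddCommMonoid M] [TopologicalSpace M] (f : ℕ → M) (j : ℕ) :
    ∑' i : Set.Ici j, f i = ∑' i, f (j + i) :=
  ((addEquivIci j).tsum_eq fun i : Set.Ici j => f i).symm

theorem summable_Ici_iff {M : Type*} [AddCommMonoid M] [TopologicalSpace M] (f : ℕ → M) (j : ℕ) :
    (Summable fun i : Set.Ici j => f i) ↔ Summable fun i => f (j + i) :=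
  ((addEquivIci j).summable_iff (f := fun i : Set.Ici j => f i)).symm

variable {ρ h : ℝ} {k j : ℕ}

theorem summand_zero_eq (α : ℝ) (η : ℂ) (hminus : poch (deltaMinus ρ h k) j ≠ 0)
    (hplus : poch (deltaPlus ρ h k) j ≠ 0) (i : ℕ) :
    summand ρ α h η 0 k j (j + i) =
      η ^ j * pathProd (fun n => singleCoeff ρ h n * η) (j + 2 * k) i := by
  rw [summand, ratio_eq_pathProd hminus hplus, pathProd_mul_const, pow_add]
  ring

theorem summand_succ_eq {α : ℝ} {η : ℂ} {m : ℕ} {S : ℕ → ℂ}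
    (hS : ∀ i, ∑' i' : Set.Ici i, summand ρ α h η m (k + 1) i i' =
      η ^ i * S (i + 2 * (k + 1)))
    (hminus : poch (deltaMinus ρ h k) j ≠ 0) (hplus : poch (deltaPlus ρ h k) j ≠ 0) (i : ℕ) :
    summand ρ α h η (m + 1) k j (j + i) =
      η ^ j * (pathProd (fun n => singleCoeff ρ h n * η) (j + 2 * k) i *
        (doubleCoeff α (j + 2 * k + i) * S (j + 2 * k + i + 2))) := by
  rw [summand, hS, ratio_eq_pathProd hminus hplus, weight_eq_doubleCoeff, pathProd_mul_const,
    pow_add, show j + i + 2 * k = j + 2 * k + i by ring,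
    show j + i + 2 * (k + 1) = j + 2 * k + i + 2 by ring]
  ring

theorem tsum_summand_eq (hh : NonResonant ρ h) (α : ℝ) (η : ℂ) (m : ℕ)
    (hminus : poch (deltaMinus ρ h k) j ≠ 0) (hplus : poch (deltaPlus ρ h k) j ≠ 0) :
    ∑' i : Set.Ici j, summand ρ α h η m k j i =
      η ^ j * levelSum (fun n => singleCoeff ρ h n * η) (doubleCoeff α) m (j + 2 * k) := by
  induction m generalizing k j with
  | zero =>
    rw [tsum_Ici_eq (summand ρ α h η 0 k j), levelSum, ← tsum_mul_left]
    exact tsum_congr (summand_zero_eq α η hminus hplus)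
  | succ m ih =>
    rw [tsum_Ici_eq (summand ρ α h η (m + 1) k j), levelSum, ← tsum_mul_left]
    exact tsum_congr (summand_succ_eq (fun i => ih (hh.poch_deltaMinus_ne_zero (by omega) i)
      (hh.poch_deltaPlus_ne_zero (by omega) i)) hminus hplus)

theorem summable_summand (hh : NonResonant ρ h) (α : ℝ) {η : ℂ} (hη : ‖η‖ < 1) (m k j : ℕ) :
    Summable fun i : Set.Ici j => summand ρ α h η m k j i := by
  rw [summable_Ici_iff (summand ρ α h η m k j)]
  by_cases hj : poch (deltaMinus ρ h k) j = 0 ∨ poch (deltaPlus ρ h k) j = 0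
  · have : ∀ i, summand ρ α h η m k j i = 0 := fun i => by
      cases m <;> simp only [summand, ratio_eq_zero hj, zero_mul, mul_zero]
    simpa only [this] using summable_zero
  · obtain ⟨hminus, hplus⟩ := not_or.1 hj
    obtain ⟨x, hηx, hx⟩ := exists_between hη
    obtain ⟨E, hE⟩ := exists_isMajorant_coeff ρ α h hηx (z := 1)
      (norm_one.trans_lt one_lt_two)
    simp only [mul_one] at hE
    cases m with
    | zero =>
      simpa only [summand_zero_eq α η hminus hplus] using (hE.summable_pathProd hx _).mul_left _
    | succ m =>
      simpa only [summand_succ_eq (fun i => tsum_summand_eq hh α η m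
        (hh.poch_deltaMinus_ne_zero (by omega) i) (hh.poch_deltaPlus_ne_zero (by omega) i))
        hminus hplus] using (hE.summable_pathProd_mul_double hx m _).mul_left _

theorem nested_mul_pow (hh : NonResonant ρ h) (α : ℝ) (η z : ℂ) (n : ℕ) :
    nested ρ α h η n * z ^ n =
      levelSum (fun n => singleCoeff ρ h n * η) (fun n => doubleCoeff α n * z) n 0 := by
  have hminus : poch (deltaMinus ρ h 0) 0 ≠ 0 := by rw [poch_zero]; exact one_ne_zero
  have hplus : poch (deltaPlus ρ h 0) 0 ≠ 0 := by rw [poch_zero]; exact one_ne_zero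
  rw [nested, tsum_summand_eq hh α η n hminus hplus, levelSum_mul_right, pow_zero, one_mul]

theorem exists_isMajorant_of_mem_disc (ρ α h : ℝ) {ξ : ℂ} (hξ : ξ ∈ disc ρ) :
    ∃ x y E, x + y < 1 ∧ IsMajorant (fun n => singleCoeff ρ h n * eta ρ ξ)
      (fun n => doubleCoeff α n * zeta ρ ξ) x y E := by
  have hlt : ‖eta ρ ξ‖ + ‖zeta ρ ξ‖ < 1 := hξ
  obtain ⟨x, hηx, hx⟩ := exists_between (lt_sub_iff_add_lt.2 hlt)
  obtain ⟨y, hzy, hy⟩ := exists_between (lt_sub_comm.1 hx)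
  obtain ⟨E, hE⟩ := exists_isMajorant_coeff ρ α h hηx hzy
  exact ⟨x, y, E, by linarith, hE⟩

theorem norm_eta_lt_one {ξ : ℂ} (hξ : ξ ∈ disc ρ) : ‖eta ρ ξ‖ < 1 :=
  (le_add_of_nonneg_right (norm_nonneg _)).trans_lt hξ

theorem summable_nested_mul_pow (hh : NonResonant ρ h) (α : ℝ) {ξ : ℂ} (hξ : ξ ∈ disc ρ) :
    Summable fun n => nested ρ α h (eta ρ ξ) n * zeta ρ ξ ^ n := by
  obtain ⟨x, y, E, hxy, hE⟩ := exists_isMajorant_of_mem_disc ρ α h hξ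
  simpa only [nested_mul_pow hh] using hE.summable_levelSum hxy 0

theorem hasSum_bracket (hh : NonResonant ρ h) (α : ℝ) {ξ : ℂ} (hξ : ξ ∈ disc ρ) :
    HasSum (fun n => seriesCoeff ρ α h n * ξ ^ n) (bracket ρ α h ξ) := by
  obtain ⟨x, y, E, hxy, hE⟩ := exists_isMajorant_of_mem_disc ρ α h hξ
  have hcoeff : pathSeq (fun n => singleCoeff ρ h n * eta ρ ξ)
      (fun n => doubleCoeff α n * zeta ρ ξ) = fun n => seriesCoeff ρ α h n * ξ ^ n := by
    simp only [eta, zeta, ← mul_assoc]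
    exact funext (pathSeq_mul_pow _ _ ξ)
  simpa only [hcoeff, bracket, pathSum, ← nested_mul_pow hh] using hE.hasSum_pathSeq hxy

end NestedSums

section Recurrence

theorem seriesCoeff_zero (ρ α h : ℝ) : seriesCoeff ρ α h 0 = 1 := rfl

theorem seriesCoeff_one (ρ α h : ℝ) :
    3 / 2 * seriesCoeff ρ α h 1 = (1 + (ρ : ℂ) ^ 2) / 4 - h / 4 := by
  have hρ := one_add_ofReal_sq_ne_zero ρ
  have hsingle : singleCoeff ρ h 0 = (1 / 4 - root ρ h ^ 2) / (3 / 2) := by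
    rw [singleCoeff]
    push_cast
    ring
  rw [seriesCoeff, pathSeq, hsingle, root_sq]
  field_simp

theorem seriesCoeff_add_two (ρ α h : ℝ) (n : ℕ) :
    ((n : ℂ) + 2) * (n + 5 / 2) * seriesCoeff ρ α h (n + 2) =
      ((1 + (ρ : ℂ) ^ 2) * (n + 3 / 2) ^ 2 - h / 4) * seriesCoeff ρ α h (n + 1) -
        (ρ : ℂ) ^ 2 * (n + 1 / 2 - α / 2) * (n + 1 + α / 2) * seriesCoeff ρ α h n := by
  have hρ := one_add_ofReal_sq_ne_zero ρ
  have htwo : (n : ℂ) + 2 ≠ 0 := by exact_mod_cast (by positivity : (n : ℝ) + 2 ≠ 0)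
  have hhalf : (n : ℂ) + 5 / 2 ≠ 0 := by
    simpa using Complex.ofReal_ne_zero.2 (by positivity : (n : ℝ) + 5 / 2 ≠ 0)
  have hsingle : ((n : ℂ) + 2) * (n + 5 / 2) * singleCoeff ρ h (n + 1) =
      (n + 3 / 2) ^ 2 - root ρ h ^ 2 := by
    have : singleCoeff ρ h (n + 1) =
        ((n + 3 / 2) ^ 2 - root ρ h ^ 2) / (((n : ℂ) + 2) * (n + 5 / 2)) := by
      rw [singleCoeff]
      push_cast
      congr 1 <;> ring
    rw [this, mul_div_cancel₀ _ (mul_ne_zero htwo hhalf)]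
  have hdouble : ((n : ℂ) + 2) * (n + 5 / 2) * doubleCoeff α n =
      (n + 1 / 2 - α / 2) * (n + 1 + α / 2) := by
    rw [doubleCoeff, mul_comm ((n : ℂ) + 2), mul_div_cancel₀ _ (mul_ne_zero hhalf htwo)]
    ring
  have hroot : (1 + (ρ : ℂ) ^ 2) * root ρ h ^ 2 = h / 4 := by
    rw [root_sq]
    field_simp
  have hrec : seriesCoeff ρ α h (n + 2) =
      singleCoeff ρ h (n + 1) * (1 + (ρ : ℂ) ^ 2) * seriesCoeff ρ α h (n + 1) +
        doubleCoeff α n * -(ρ : ℂ) ^ 2 * seriesCoeff ρ α h n := rfl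
  rw [hrec]
  linear_combination (1 + (ρ : ℂ) ^ 2) * seriesCoeff ρ α h (n + 1) * hsingle -
    (ρ : ℂ) ^ 2 * seriesCoeff ρ α h n * hdouble - seriesCoeff ρ α h (n + 1) * hroot

end Recurrence

section Disc

variable {ρ : ℝ} {ξ : ℂ}

theorem mem_disc_iff : ξ ∈ disc ρ ↔ (1 + ρ ^ 2) * ‖ξ‖ + ρ ^ 2 * ‖ξ‖ ^ 2 < 1 := by
  have heta : ‖eta ρ ξ‖ = (1 + ρ ^ 2) * ‖ξ‖ := by
    have : ‖(1 + (ρ : ℂ) ^ 2)‖ = 1 + ρ ^ 2 := by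
      exact_mod_cast Complex.norm_of_nonneg (by positivity : 0 ≤ 1 + ρ ^ 2)
    rw [eta, norm_mul, this]
  have hzeta : ‖zeta ρ ξ‖ = ρ ^ 2 * ‖ξ‖ ^ 2 := by
    rw [zeta, norm_mul, norm_neg, norm_pow, norm_pow, Complex.norm_real, Real.norm_eq_abs, sq_abs]
  rw [disc, Set.mem_ofPred_eq, heta, hzeta]

theorem zero_mem_disc (ρ : ℝ) : 0 ∈ disc ρ := by
  simp [mem_disc_iff]

theorem exists_mem_ball_subset_disc (hξ : ξ ∈ disc ρ) :
    ∃ r, ξ ∈ Metric.ball 0 r ∧ Metric.ball 0 r ⊆ disc ρ := by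
  have hcont : ContinuousAt (fun t : ℝ => (1 + ρ ^ 2) * t + ρ ^ 2 * t ^ 2) ‖ξ‖ := by fun_prop
  obtain ⟨r, hr, hξr⟩ := (((hcont.eventually_lt_const (mem_disc_iff.1 hξ)).filter_mono
    nhdsWithin_le_nhds).and (self_mem_nhdsWithin (s := Set.Ioi ‖ξ‖))).exists
  refine ⟨r, mem_ball_zero_iff.2 hξr, fun w hw => mem_disc_iff.2 (lt_of_le_of_lt ?_ hr)⟩
  have := (mem_ball_zero_iff.1 hw).le
  gcongr

theorem one_sub_ne_zero_of_mem_disc (hξ : ξ ∈ disc ρ) : 1 - ξ ≠ 0 := by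
  intro h
  rw [mem_disc_iff, ← sub_eq_zero.1 h, norm_one] at hξ
  nlinarith [sq_nonneg ρ]

theorem one_sub_sq_mul_ne_zero_of_mem_disc (hξ : ξ ∈ disc ρ) : 1 - (ρ : ℂ) ^ 2 * ξ ≠ 0 := by
  intro h
  have hnorm : ρ ^ 2 * ‖ξ‖ = 1 := by
    rw [← norm_one (α := ℂ), sub_eq_zero.1 h, norm_mul, norm_pow, Complex.norm_real,
      Real.norm_eq_abs, sq_abs]
  rw [mem_disc_iff] at hξ
  nlinarith [norm_nonneg ξ, sq_nonneg (ρ * ‖ξ‖)]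

end Disc

section Euler

/-- The Euler operator `ξ d/dξ`. -/
def euler (f : ℂ → ℂ) (ξ : ℂ) : ℂ :=
  ξ * deriv f ξ

theorem euler_euler {f : ℂ → ℂ} {ξ : ℂ} (hf : AnalyticAt ℂ f ξ) :
    euler (euler f) ξ = ξ * deriv f ξ + ξ ^ 2 * deriv (deriv f) ξ := by
  have hderiv : HasDerivAt (euler f) (1 * deriv f ξ + ξ * deriv (deriv f) ξ) ξ :=
    (hasDerivAt_id ξ).mul hf.deriv.differentiableAt.hasDerivAt
  rw [euler, hderiv.deriv]
  ring

theorem analyticAt_euler {f : ℂ → ℂ} {ξ : ℂ} (hf : AnalyticAt ℂ f ξ) : AnalyticAt ℂ (euler f) ξ :=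
  analyticAt_id.mul hf.deriv

section PowerSeries

variable {c : ℕ → ℂ} {f : ℂ → ℂ} {r : ℝ}

theorem exists_summable_norm_mul_pow
    (hf : ∀ ξ ∈ Metric.ball 0 r, HasSum (fun n => c n * ξ ^ n) (f ξ)) {ξ : ℂ}
    (hξ : ξ ∈ Metric.ball 0 r) : ∃ s, ‖ξ‖ < s ∧ s ≤ r ∧ Summable fun n => ‖c n‖ * s ^ n := by
  obtain ⟨s, hξs, hsr⟩ := exists_between (mem_ball_zero_iff.1 hξ)
  have hs : ‖(s : ℂ)‖ = s := Complex.norm_of_nonneg ((norm_nonneg ξ).trans hξs.le)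
  refine ⟨s, hξs, hsr.le, ?_⟩
  simpa only [norm_mul, norm_pow, hs] using (hf s (by rwa [mem_ball_zero_iff, hs])).summable.norm

theorem norm_mul_pow_le (n : ℕ) (w : ℂ) (hw : w ∈ Metric.ball 0 r) :
    ‖c n * w ^ n‖ ≤ ‖c n‖ * r ^ n := by
  have := (mem_ball_zero_iff.1 hw).le
  rw [norm_mul, norm_pow]
  gcongr

theorem eventuallyEq_tsum_pow
    (hf : ∀ ξ ∈ Metric.ball 0 r, HasSum (fun n => c n * ξ ^ n) (f ξ)) {ξ : ℂ}
    (hξ : ξ ∈ Metric.ball 0 r) : f =ᶠ[𝓝 ξ] fun w => ∑' n, c n * w ^ n := by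
  filter_upwards [Metric.isOpen_ball.mem_nhds hξ] with w hw
  exact (hf w hw).tsum_eq.symm

theorem analyticAt_of_hasSum_pow
    (hf : ∀ ξ ∈ Metric.ball 0 r, HasSum (fun n => c n * ξ ^ n) (f ξ)) {ξ : ℂ}
    (hξ : ξ ∈ Metric.ball 0 r) : AnalyticAt ℂ f ξ := by
  obtain ⟨s, hξs, -, hsum⟩ := exists_summable_norm_mul_pow hf hξ
  have htsum : DifferentiableOn ℂ (fun w => ∑' n, c n * w ^ n) (Metric.ball 0 s) :=
    Complex.differentiableOn_tsum_of_summable_norm hsum (fun n => by fun_prop) Metric.isOpen_ball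
      norm_mul_pow_le
  exact (htsum.analyticAt (Metric.isOpen_ball.mem_nhds (mem_ball_zero_iff.2 hξs))).congr
    (eventuallyEq_tsum_pow hf hξ).symm

theorem hasSum_euler
    (hf : ∀ ξ ∈ Metric.ball 0 r, HasSum (fun n => c n * ξ ^ n) (f ξ)) {ξ : ℂ}
    (hξ : ξ ∈ Metric.ball 0 r) : HasSum (fun n => n * c n * ξ ^ n) (euler f ξ) := by
  obtain ⟨s, hξs, -, hsum⟩ := exists_summable_norm_mul_pow hf hξ
  have hderiv := Complex.hasSum_deriv_of_summable_norm hsum (fun n => by fun_prop)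
    Metric.isOpen_ball norm_mul_pow_le (mem_ball_zero_iff.2 hξs)
  rw [euler, (eventuallyEq_tsum_pow hf hξ).deriv_eq]
  have hterm (n : ℕ) : ξ * deriv (fun w => c n * w ^ n) ξ = n * c n * ξ ^ n := by
    rw [deriv_const_mul_field, deriv_pow_field]
    cases n with
    | zero => simp only [CharP.cast_eq_zero, zero_mul, mul_zero]
    | succ n =>
      rw [Nat.add_sub_cancel]
      ring
  simpa only [hterm] using hderiv.mul_left ξ

end PowerSeries

theorem eq_add_of_hasSum_of_recurrence {M : Type*} [AddCommGroup M] [TopologicalSpace M]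
    [IsTopologicalAddGroup M] [T2Space M] {u v w : ℕ → M} {U V W : M} (hu₀ : u 0 = 0)
    (hu₁ : u 1 = v 0) (hu : ∀ n, u (n + 2) = v (n + 1) + w n)
    (hU : HasSum u U) (hV : HasSum v V) (hW : HasSum w W) : U = V + W := by
  have hu_shift := (hasSum_nat_add_iff' 2).2 hU
  have hv_shift := (hasSum_nat_add_iff' 1).2 hV
  simp only [hu, sum_range_succ, range_zero, sum_empty, zero_add, hu₀, hu₁] at hu_shift hv_shift
  have := hu_shift.unique (hv_shift.add hW)
  rwa [sub_add_eq_add_sub, sub_left_inj] at this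

theorem euler_equation_of_recurrence {c : ℕ → ℂ} {g : ℂ → ℂ} {r : ℝ} {k α h : ℂ}
    (hg : ∀ ξ ∈ Metric.ball 0 r, HasSum (fun n => c n * ξ ^ n) (g ξ))
    (hc₁ : 3 / 2 * c 1 = ((1 + k) / 4 - h / 4) * c 0)
    (hc : ∀ n : ℕ, ((n : ℂ) + 2) * (n + 5 / 2) * c (n + 2) =
      ((1 + k) * (n + 3 / 2) ^ 2 - h / 4) * c (n + 1) -
        k * (n + 1 / 2 - α / 2) * (n + 1 + α / 2) * c n)
    {ξ : ℂ} (hξ : ξ ∈ Metric.ball 0 r) :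
    euler (euler g) ξ + euler g ξ / 2 =
      ξ * ((1 + k) * (euler (euler g) ξ + euler g ξ + g ξ / 4) - h / 4 * g ξ) -
        k * ξ ^ 2 * (euler (euler g) ξ + 3 / 2 * euler g ξ +
          (1 / 2 - α / 2) * (1 + α / 2) * g ξ) := by
  have hg₀ := hg ξ hξ
  have hg₁ := hasSum_euler hg hξ
  have hg₂ := hasSum_euler (fun _ => hasSum_euler hg) hξ
  rw [sub_eq_add_neg]
  refine eq_add_of_hasSum_of_recurrence ?_ ?_ ?_ (hg₂.add (hg₁.div_const 2))
    ((((hg₂.add hg₁).add (hg₀.div_const 4)).mul_left (1 + k)).sub (hg₀.mul_left (h / 4))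
      |>.mul_left ξ)
    (((hg₂.add (hg₁.mul_left (3 / 2))).add
      (hg₀.mul_left ((1 / 2 - α / 2) * (1 + α / 2)))).mul_left (k * ξ ^ 2)).neg
  · simp
  · push_cast
    linear_combination ξ * hc₁
  · intro n
    push_cast
    linear_combination ξ ^ (n + 2) * hc n

end Euler

section LameOperator

/-- Lamé's operator in the variable `ξ` with denominators cleared,
`4ξ(1 - ξ)(1 - kξ) d²/dξ² + 2(1 - 2(1 + k)ξ + 3kξ²) d/dξ + (h - α(α + 1)kξ)`, where `k = ρ²`. -/
def lameOperator (k α h : ℂ) (y : ℂ → ℂ) (ξ : ℂ) : ℂ :=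
  4 * ξ * (1 - ξ) * (1 - k * ξ) * deriv (deriv y) ξ +
    2 * (1 - 2 * (1 + k) * ξ + 3 * k * ξ ^ 2) * deriv y ξ + (h - α * (α + 1) * k * ξ) * y ξ

theorem mul_lameOperator_eq (k α h : ℂ) {y : ℂ → ℂ} {ξ : ℂ} (hy : AnalyticAt ℂ y ξ) :
    ξ * lameOperator k α h y ξ =
      4 * (euler (euler y) ξ - euler y ξ / 2) -
        4 * ξ * ((1 + k) * euler (euler y) ξ - h / 4 * y ξ) +
        4 * k * ξ ^ 2 * (euler (euler y) ξ + euler y ξ / 2 - α * (α + 1) / 4 * y ξ) := by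
  rw [euler_euler hy, euler, lameOperator]
  ring

theorem euler_sqrt_mul {f : ℂ → ℂ} {ξ : ℂ} (hξ : ξ ∈ Complex.slitPlane)
    (hf : DifferentiableAt ℂ f ξ) :
    euler (fun w => w ^ (1 / 2 : ℂ) * f w) ξ = ξ ^ (1 / 2 : ℂ) * (f ξ / 2 + euler f ξ) := by
  have hξ₀ := Complex.slitPlane_ne_zero hξ
  have hderiv := ((hasDerivAt_id' ξ).cpow_const (c := 1 / 2) hξ).fun_mul hf.hasDerivAt
  have hsqrt : ξ * ξ ^ (1 / 2 - 1 : ℂ) = ξ ^ (1 / 2 : ℂ) := by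
    rw [Complex.cpow_sub _ _ hξ₀, Complex.cpow_one, mul_div_cancel₀ _ hξ₀]
  rw [euler, hderiv.deriv, euler]
  linear_combination f ξ / 2 * hsqrt

theorem euler_euler_sqrt_mul {f : ℂ → ℂ} {ξ : ℂ} (hξ : ξ ∈ Complex.slitPlane)
    (hf : AnalyticAt ℂ f ξ) :
    euler (euler fun w => w ^ (1 / 2 : ℂ) * f w) ξ =
      ξ ^ (1 / 2 : ℂ) * (f ξ / 4 + euler f ξ + euler (euler f) ξ) := by
  have hlocal : (euler fun w => w ^ (1 / 2 : ℂ) * f w) =ᶠ[𝓝 ξ]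
      fun w => w ^ (1 / 2 : ℂ) * (f w / 2 + euler f w) := by
    filter_upwards [Complex.isOpen_slitPlane.mem_nhds hξ, hf.eventually_analyticAt] with w hw hfw
    exact euler_sqrt_mul hw hfw.differentiableAt
  have hf' := hf.differentiableAt
  have hEf := (analyticAt_euler hf).differentiableAt
  have hadd : euler (fun w => f w / 2 + euler f w) ξ = euler f ξ / 2 + euler (euler f) ξ := by
    rw [euler, deriv_fun_add (hf'.div_const 2) hEf, deriv_div_const, mul_add, mul_div_assoc', euler,
      euler]
  rw [euler, hlocal.deriv_eq, ← euler, euler_sqrt_mul hξ ((hf'.div_const 2).fun_add hEf), hadd]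
  ring

theorem analyticAt_sqrt_mul {f : ℂ → ℂ} {ξ : ℂ} (hξ : ξ ∈ Complex.slitPlane)
    (hf : AnalyticAt ℂ f ξ) : AnalyticAt ℂ (fun w => w ^ (1 / 2 : ℂ) * f w) ξ :=
  (analyticAt_id.cpow analyticAt_const hξ).mul hf

theorem lameOperator_sqrt_mul_eq_zero {k α h ξ : ℂ} {g : ℂ → ℂ} (hξ : ξ ∈ Complex.slitPlane)
    (hg : AnalyticAt ℂ g ξ)
    (heuler : euler (euler g) ξ + euler g ξ / 2 =
      ξ * ((1 + k) * (euler (euler g) ξ + euler g ξ + g ξ / 4) - h / 4 * g ξ) -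
        k * ξ ^ 2 * (euler (euler g) ξ + 3 / 2 * euler g ξ +
          (1 / 2 - α / 2) * (1 + α / 2) * g ξ)) :
    lameOperator k α h (fun w => w ^ (1 / 2 : ℂ) * g w) ξ = 0 := by
  have hmul := mul_lameOperator_eq k α h (analyticAt_sqrt_mul hξ hg)
  rw [euler_euler_sqrt_mul hξ hg, euler_sqrt_mul hξ hg.differentiableAt] at hmul
  refine (mul_eq_zero.1 (hmul.trans ?_)).resolve_left (Complex.slitPlane_ne_zero hξ)
  linear_combination 4 * ξ ^ (1 / 2 : ℂ) * heuler

theorem lame_equation_of_lameOperator_eq_zero {k α h ξ : ℂ} {y : ℂ → ℂ} (hk : k ≠ 0)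
    (hξ₀ : ξ ≠ 0) (hξ₁ : 1 - ξ ≠ 0) (hkξ : 1 - k * ξ ≠ 0) (hy : lameOperator k α h y ξ = 0) :
    deriv (deriv y) ξ + 1 / 2 * (1 / ξ + 1 / (ξ - 1) + 1 / (ξ - k⁻¹)) * deriv y ξ +
      (-α * (α + 1) * ξ + h * k⁻¹) / (4 * ξ * (ξ - 1) * (ξ - k⁻¹)) * y ξ = 0 := by
  rw [mul_comm] at hkξ
  have hinv : ξ - k⁻¹ = -(1 - ξ * k) / k := by
    rw [neg_sub, sub_div, mul_div_cancel_right₀ _ hk, one_div]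
  rw [lameOperator] at hy
  rw [hinv, ← neg_sub 1 ξ]
  field_simp
  linear_combination 2 * hy

end LameOperator

section Bracket

variable {ρ h : ℝ} {ξ : ℂ}

theorem analyticAt_bracket (hh : NonResonant ρ h) (α : ℝ) (hξ : ξ ∈ disc ρ) :
    AnalyticAt ℂ (bracket ρ α h) ξ := by
  obtain ⟨r, hξr, hr⟩ := exists_mem_ball_subset_disc hξ
  exact analyticAt_of_hasSum_pow (fun w hw => hasSum_bracket hh α (hr hw)) hξr

theorem bracket_zero (hh : NonResonant ρ h) (α : ℝ) : bracket ρ α h 0 = 1 := by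
  refine (hasSum_bracket hh α (zero_mem_disc ρ)).unique ?_
  simpa [seriesCoeff_zero] using
    hasSum_single (f := fun n => seriesCoeff ρ α h n * 0 ^ n) 0 fun n hn => by simp [hn]

theorem analyticAt_LS (hh : NonResonant ρ h) (α : ℝ) (hξ : ξ ∈ disc ρ ∩ Complex.slitPlane) :
    AnalyticAt ℂ (LS ρ α h) ξ :=
  analyticAt_sqrt_mul hξ.2 (analyticAt_bracket hh α hξ.1)

theorem lameOperator_LS (hh : NonResonant ρ h) (α : ℝ) (hξ : ξ ∈ disc ρ ∩ Complex.slitPlane) :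
    lameOperator ((ρ : ℂ) ^ 2) α h (LS ρ α h) ξ = 0 := by
  obtain ⟨r, hξr, hr⟩ := exists_mem_ball_subset_disc hξ.1
  refine lameOperator_sqrt_mul_eq_zero hξ.2 (analyticAt_bracket hh α hξ.1)
    (euler_equation_of_recurrence (fun w hw => hasSum_bracket hh α (hr hw)) ?_
      (seriesCoeff_add_two ρ α h) hξr)
  rw [seriesCoeff_one, seriesCoeff_zero, mul_one]

theorem lame_equation_LS (hh : NonResonant ρ h) (hρ : ρ ≠ 0) (α : ℝ)
    (hξ : ξ ∈ disc ρ ∩ Complex.slitPlane) :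
    deriv (deriv (LS ρ α h)) ξ +
        1 / 2 * (1 / ξ + 1 / (ξ - 1) + 1 / (ξ - ((ρ : ℂ) ^ 2)⁻¹)) * deriv (LS ρ α h) ξ +
        (-(α : ℂ) * ((α : ℂ) + 1) * ξ + (h : ℂ) * ((ρ : ℂ) ^ 2)⁻¹) /
            (4 * ξ * (ξ - 1) * (ξ - ((ρ : ℂ) ^ 2)⁻¹)) * LS ρ α h ξ = 0 :=
  lame_equation_of_lameOperator_eq_zero (pow_ne_zero 2 (Complex.ofReal_ne_zero.2 hρ))
    (Complex.slitPlane_ne_zero hξ.2) (one_sub_ne_zero_of_mem_disc hξ.1)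
    (one_sub_sq_mul_ne_zero_of_mem_disc hξ.1) (lameOperator_LS hh α hξ)

end Bracket

section Inverse

variable {f f' : ℝ → ℝ} {c : ℝ}

theorem surjective_of_hasDerivAt_ge (hf : ∀ x, HasDerivAt f (f' x) x) (hc : 0 < c)
    (hf' : ∀ x, c ≤ f' x) : Function.Surjective f := by
  have hdiff : Differentiable ℝ f := fun x => (hf x).differentiableAt
  have hderiv (x : ℝ) : c ≤ deriv f x := (hf x).deriv ▸ hf' x
  have hgrowth := mul_sub_le_image_sub_of_le_deriv hdiff hderiv
  refine hdiff.continuous.surjective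
    (tendsto_atTop_mono' (f₁ := fun x => c * x + f 0) _ ?_
      (tendsto_atTop_add_const_right _ _ (tendsto_id.const_mul_atTop hc)))
    (tendsto_atBot_mono' (f₁ := fun x => c * x + f 0) _ ?_
      (tendsto_atBot_add_const_right _ _ (tendsto_id.const_mul_atBot hc)))
  · filter_upwards [eventually_ge_atTop 0] with x hx
    linarith [hgrowth hx]
  · filter_upwards [eventually_le_atBot 0] with x hx
    linarith [hgrowth hx]

theorem hasDerivAt_invFun (hf : ∀ x, HasDerivAt f (f' x) x) (hc : 0 < c) (hf' : ∀ x, c ≤ f' x)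
    (u : ℝ) : HasDerivAt (Function.invFun f) (f' (Function.invFun f u))⁻¹ u := by
  have hpos (x : ℝ) : 0 < f' x := hc.trans_le (hf' x)
  have hmono : StrictMono f := strictMono_of_hasDerivAt_pos hf hpos
  have hright := Function.rightInverse_invFun (surjective_of_hasDerivAt_ge hf hc hf')
  have hinv_mono : Monotone (Function.invFun f) := fun a b hab =>
    hmono.le_iff_le.1 (by rwa [hright a, hright b])
  have hinv_cont := hinv_mono.continuous_of_surjective
    (Function.leftInverse_invFun hmono.injective).surjective
  exact .of_local_left_inverse hinv_cont.continuousAt (hf _) (hpos _).ne' (.of_forall hright)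

end Inverse

section Jacobi

/-- The Jacobi elliptic function `cn(u, ρ)` of a real argument. -/
def cn (ρ u : ℝ) : ℝ :=
  Real.cos (am ρ u)

/-- The Jacobi elliptic function `dn(u, ρ)` of a real argument. -/
def dn (ρ u : ℝ) : ℝ :=
  √(1 - ρ ^ 2 * sn ρ u ^ 2)

variable {ρ : ℝ}

theorem one_sub_sq_mul_sin_sq_pos (hρ : |ρ| < 1) (θ : ℝ) : 0 < 1 - ρ ^ 2 * Real.sin θ ^ 2 := by
  have hρ_sq : ρ ^ 2 < 1 := (sq_lt_one_iff_abs_lt_one ρ).2 hρ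
  nlinarith [Real.sin_sq_le_one θ, sq_nonneg ρ]

theorem dn_pos (hρ : |ρ| < 1) (u : ℝ) : 0 < dn ρ u :=
  Real.sqrt_pos.2 (one_sub_sq_mul_sin_sq_pos hρ _)

theorem cn_sq (ρ u : ℝ) : cn ρ u ^ 2 = 1 - sn ρ u ^ 2 :=
  Real.cos_sq' _

theorem dn_sq (hρ : |ρ| < 1) (u : ℝ) : dn ρ u ^ 2 = 1 - ρ ^ 2 * sn ρ u ^ 2 :=
  Real.sq_sqrt (one_sub_sq_mul_sin_sq_pos hρ _).le

theorem hasDerivAt_ellipticF (hρ : |ρ| < 1) (φ : ℝ) :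
    HasDerivAt (ellipticF ρ) (1 / √(1 - ρ ^ 2 * Real.sin φ ^ 2)) φ := by
  have hcont : Continuous fun θ => 1 / √(1 - ρ ^ 2 * Real.sin θ ^ 2) :=
    continuous_const.div (by fun_prop)
      fun θ => (Real.sqrt_pos.2 (one_sub_sq_mul_sin_sq_pos hρ θ)).ne'
  exact (hcont.integral_hasStrictDerivAt 0 φ).hasDerivAt

theorem hasDerivAt_am (hρ : |ρ| < 1) (u : ℝ) : HasDerivAt (am ρ) (dn ρ u) u := by
  have hone_le (φ : ℝ) : 1 ≤ 1 / √(1 - ρ ^ 2 * Real.sin φ ^ 2) := by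
    rw [le_div_iff₀ (Real.sqrt_pos.2 (one_sub_sq_mul_sin_sq_pos hρ φ)), one_mul, Real.sqrt_le_one,
      sub_le_self_iff]
    positivity
  refine (hasDerivAt_invFun (hasDerivAt_ellipticF hρ) zero_lt_one hone_le u).congr_deriv ?_
  rw [one_div, inv_inv, dn, sn, am]

theorem hasDerivAt_sn (hρ : |ρ| < 1) (u : ℝ) : HasDerivAt (sn ρ) (cn ρ u * dn ρ u) u :=
  (hasDerivAt_am hρ u).sin

theorem hasDerivAt_cn (hρ : |ρ| < 1) (u : ℝ) : HasDerivAt (cn ρ) (-sn ρ u * dn ρ u) u :=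
  (hasDerivAt_am hρ u).cos

theorem hasDerivAt_dn (hρ : |ρ| < 1) (u : ℝ) :
    HasDerivAt (dn ρ) (-(ρ ^ 2 * sn ρ u * cn ρ u)) u := by
  have hradicand := (((hasDerivAt_sn hρ u).pow 2).const_mul (ρ ^ 2)).const_sub 1
  refine (hradicand.sqrt (one_sub_sq_mul_sin_sq_pos hρ _).ne').congr_deriv ?_
  have hdn := (dn_pos hρ u).ne'
  rw [show √(1 - ρ ^ 2 * (sn ρ ^ 2) u) = dn ρ u from rfl]
  field_simp
  ring

theorem hasDerivAt_sn_sq (hρ : |ρ| < 1) (u : ℝ) :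
    HasDerivAt (fun v => sn ρ v ^ 2) (2 * sn ρ u * cn ρ u * dn ρ u) u := by
  refine ((hasDerivAt_sn hρ u).pow 2).congr_deriv ?_
  ring

theorem hasDerivAt_sn_mul_cn_mul_dn (hρ : |ρ| < 1) (u : ℝ) :
    HasDerivAt (fun v => 2 * sn ρ v * cn ρ v * dn ρ v)
      (2 * (1 - 2 * (1 + ρ ^ 2) * sn ρ u ^ 2 + 3 * ρ ^ 2 * (sn ρ u ^ 2) ^ 2)) u := by
  refine ((((hasDerivAt_sn hρ u).const_mul 2).mul (hasDerivAt_cn hρ u)).mul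
    (hasDerivAt_dn hρ u)).congr_deriv ?_
  simp only [Pi.mul_apply]
  linear_combination (2 * dn ρ u ^ 2 - 2 * ρ ^ 2 * sn ρ u ^ 2) * cn_sq ρ u +
    (2 - 4 * sn ρ u ^ 2) * dn_sq hρ u

end Jacobi

section Weierstrass

theorem hasDerivAt_deriv_comp {y : ℂ → ℂ} {x x' : ℝ → ℂ} {x'' : ℂ} {u : ℝ}
    (hy : AnalyticAt ℂ y (x u)) (hx : ∀ᶠ v in 𝓝 u, HasDerivAt x (x' v) v)
    (hx' : HasDerivAt x' x'' u) :
    HasDerivAt (deriv fun v => y (x v))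
      (deriv (deriv y) (x u) * x' u ^ 2 + deriv y (x u) * x'') u := by
  have hderiv : (deriv fun v => y (x v)) =ᶠ[𝓝 u] fun v => deriv y (x v) * x' v := by
    filter_upwards [hx, hx.self_of_nhds.continuousAt.eventually hy.eventually_analyticAt]
      with v hxv hyv
    exact (hyv.differentiableAt.hasDerivAt.comp v hxv).deriv
  have hprod := (hy.deriv.differentiableAt.hasDerivAt.comp u hx.self_of_nhds).mul hx'
  refine (hprod.congr_of_eventuallyEq hderiv).congr_deriv ?_
  simp only [Function.comp_apply]
  ring

theorem hasDerivAt_deriv_comp_sn_sq {ρ : ℝ} (hρ : |ρ| < 1) (α h : ℂ) {y : ℂ → ℂ} {u : ℝ}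
    (hy : AnalyticAt ℂ y ((sn ρ u : ℂ) ^ 2)) :
    HasDerivAt (deriv fun v => y ((sn ρ v : ℂ) ^ 2))
      (lameOperator ((ρ : ℂ) ^ 2) α h y ((sn ρ u : ℂ) ^ 2) +
        (α * (α + 1) * (ρ : ℂ) ^ 2 * (sn ρ u : ℂ) ^ 2 - h) * y ((sn ρ u : ℂ) ^ 2)) u := by
  have hx (v : ℝ) := (hasDerivAt_sn_sq hρ v).ofReal_comp
  have hx' := (hasDerivAt_sn_mul_cn_mul_dn hρ u).ofReal_comp
  have hcn : (cn ρ u : ℂ) ^ 2 = 1 - (sn ρ u : ℂ) ^ 2 := by exact_mod_cast cn_sq ρ u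
  have hdn : (dn ρ u : ℂ) ^ 2 = 1 - (ρ : ℂ) ^ 2 * (sn ρ u : ℂ) ^ 2 := by exact_mod_cast dn_sq hρ u
  push_cast at hx hx'
  refine (hasDerivAt_deriv_comp (x := fun v => (sn ρ v : ℂ) ^ 2) hy (.of_forall hx)
    hx').congr_deriv ?_
  rw [lameOperator, mul_pow, mul_pow, mul_pow, hcn, hdn]
  ring

theorem sn_sq_mem_slitPlane {ρ u : ℝ} (hu : sn ρ u ≠ 0) : (sn ρ u : ℂ) ^ 2 ∈ Complex.slitPlane := by
  rw [← Complex.ofReal_pow, Complex.ofReal_mem_slitPlane]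
  positivity

theorem hasDerivAt_deriv_LS_sn_sq {ρ h : ℝ} (hh : NonResonant ρ h) (hρ : |ρ| < 1) (α : ℝ) {u : ℝ}
    (hu : (sn ρ u : ℂ) ^ 2 ∈ disc ρ ∩ Complex.slitPlane) :
    HasDerivAt (deriv fun v => LS ρ α h ((sn ρ v : ℂ) ^ 2))
      (((α : ℂ) * ((α : ℂ) + 1) * (ρ : ℂ) ^ 2 * (sn ρ u : ℂ) ^ 2 - h) *
        LS ρ α h ((sn ρ u : ℂ) ^ 2)) u := by
  simpa only [lameOperator_LS hh α hu, zero_add] using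
    hasDerivAt_deriv_comp_sn_sq hρ α h (analyticAt_LS hh α hu)

theorem differentiableAt_LS_sn_sq {ρ h : ℝ} (hh : NonResonant ρ h) (hρ : |ρ| < 1) (α : ℝ) {u : ℝ}
    (hu : (sn ρ u : ℂ) ^ 2 ∈ disc ρ ∩ Complex.slitPlane) :
    DifferentiableAt ℝ (fun v : ℝ => LS ρ α h ((sn ρ v : ℂ) ^ 2)) u := by
  have hLS := (analyticAt_LS hh α hu).differentiableAt.hasDerivAt
  exact (hLS.comp u ((hasDerivAt_sn hρ u).ofReal_comp.fun_pow 2)).differentiableAt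

end Weierstrass

end Lame

end

theorem mainTheorem4_general (ρ α h : ℝ)
    (hh : ∀ m : ℕ, h ≠ 4 * (1 + ρ ^ 2) * ((m : ℝ) + 5 / 2) ^ 2) :
    (∀ k i : ℕ, 1 ≤ k →
      Lame.poch (Lame.deltaMinus ρ h k) i ≠ 0 ∧ Lame.poch (Lame.deltaPlus ρ h k) i ≠ 0) ∧
    (∀ ξ ∈ Lame.disc ρ,
      (∀ m k j : ℕ,
        Summable fun i : Set.Ici j => Lame.summand ρ α h (Lame.eta ρ ξ) m k j i) ∧
      Summable fun n : ℕ =>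
        Lame.nested ρ α h (Lame.eta ρ ξ) n * Lame.zeta ρ ξ ^ n) ∧
    DifferentiableOn ℂ (Lame.bracket ρ α h) (Lame.disc ρ) ∧
    Lame.bracket ρ α h 0 = 1 ∧
    DifferentiableOn ℂ (Lame.LS ρ α h) (Lame.disc ρ ∩ Complex.slitPlane) ∧
    (ρ ≠ 0 → ∀ ξ ∈ Lame.disc ρ ∩ Complex.slitPlane,
      deriv (deriv (Lame.LS ρ α h)) ξ +
        1 / 2 * (1 / ξ + 1 / (ξ - 1) + 1 / (ξ - ((ρ : ℂ) ^ 2)⁻¹)) *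
          deriv (Lame.LS ρ α h) ξ +
        (-(α : ℂ) * ((α : ℂ) + 1) * ξ + (h : ℂ) * ((ρ : ℂ) ^ 2)⁻¹) /
            (4 * ξ * (ξ - 1) * (ξ - ((ρ : ℂ) ^ 2)⁻¹)) *
          Lame.LS ρ α h ξ = 0) ∧
    (|ρ| < 1 → ∀ u : ℝ, Lame.sn ρ u ≠ 0 → ((Lame.sn ρ u : ℂ) ^ 2) ∈ Lame.disc ρ →
      DifferentiableAt ℝ (fun v : ℝ => Lame.LS ρ α h ((Lame.sn ρ v : ℂ) ^ 2)) u ∧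
      DifferentiableAt ℝ
        (deriv fun v : ℝ => Lame.LS ρ α h ((Lame.sn ρ v : ℂ) ^ 2)) u ∧
      deriv (deriv fun v : ℝ => Lame.LS ρ α h ((Lame.sn ρ v : ℂ) ^ 2)) u =
        ((α : ℂ) * ((α : ℂ) + 1) * (ρ : ℂ) ^ 2 * (Lame.sn ρ u : ℂ) ^ 2 - (h : ℂ)) *
          Lame.LS ρ α h ((Lame.sn ρ u : ℂ) ^ 2)) := by
  have hnr : Lame.NonResonant ρ h := hh
  refine ⟨fun k i hk => ⟨hnr.poch_deltaMinus_ne_zero hk i, hnr.poch_deltaPlus_ne_zero hk i⟩,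
    fun ξ hξ => ⟨Lame.summable_summand hnr α (Lame.norm_eta_lt_one hξ),
      Lame.summable_nested_mul_pow hnr α hξ⟩,
    fun ξ hξ => (Lame.analyticAt_bracket hnr α hξ).differentiableAt.differentiableWithinAt,
    Lame.bracket_zero hnr α,
    fun ξ hξ => (Lame.analyticAt_LS hnr α hξ).differentiableAt.differentiableWithinAt,
    fun hρ ξ hξ => Lame.lame_equation_LS hnr hρ α hξ, fun hρ u hu hdisc => ?_⟩
  have hmem := And.intro hdisc (Lame.sn_sq_mem_slitPlane hu)
  have hsecond := Lame.hasDerivAt_deriv_LS_sn_sq hnr hρ α hmem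
  exact ⟨Lame.differentiableAt_LS_sn_sq hnr hρ α hmem, hsecond.differentiableAt, hsecond.deriv⟩

theorem mainTheorem4 (ρ α h : ℝ) (hρ0 : 0 < ρ) (hρ1 : ρ < 1)
    (hh : ∀ m : ℕ, h ≠ 4 * (1 + ρ ^ 2) * ((m : ℝ) + 5 / 2) ^ 2) :
    -- no denominator of the nested series vanishes
    (∀ k i : ℕ, 1 ≤ k →
      Lame.poch (Lame.deltaMinus ρ h k) i ≠ 0 ∧ Lame.poch (Lame.deltaPlus ρ h k) i ≠ 0) ∧
    -- all sums of the nested series converge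
    (∀ ξ ∈ Lame.disc ρ,
      (∀ m k j : ℕ,
        Summable fun i : Set.Ici j => Lame.summand ρ α h (Lame.eta ρ ξ) m k j i) ∧
      Summable fun n : ℕ =>
        Lame.nested ρ α h (Lame.eta ρ ξ) n * Lame.zeta ρ ξ ^ n) ∧
    -- the exponent at `ξ = 0` is `1/2`, with leading coefficient `1`
    DifferentiableOn ℂ (Lame.bracket ρ α h) (Lame.disc ρ) ∧
    Lame.bracket ρ α h 0 = 1 ∧
    -- the equation in the variable `ξ`
    DifferentiableOn ℂ (Lame.LS ρ α h) (Lame.disc ρ ∩ Complex.slitPlane) ∧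
    (∀ ξ ∈ Lame.disc ρ ∩ Complex.slitPlane,
      deriv (deriv (Lame.LS ρ α h)) ξ +
        1 / 2 * (1 / ξ + 1 / (ξ - 1) + 1 / (ξ - ((ρ : ℂ) ^ 2)⁻¹)) *
          deriv (Lame.LS ρ α h) ξ +
        (-(α : ℂ) * ((α : ℂ) + 1) * ξ + (h : ℂ) * ((ρ : ℂ) ^ 2)⁻¹) /
            (4 * ξ * (ξ - 1) * (ξ - ((ρ : ℂ) ^ 2)⁻¹)) *
          Lame.LS ρ α h ξ = 0) ∧
    -- the equation in the variable `u`, where `ξ = sn²(u, ρ)`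
    (∀ u : ℝ, Lame.sn ρ u ≠ 0 → ((Lame.sn ρ u : ℂ) ^ 2) ∈ Lame.disc ρ →
      DifferentiableAt ℝ (fun v : ℝ => Lame.LS ρ α h ((Lame.sn ρ v : ℂ) ^ 2)) u ∧
      DifferentiableAt ℝ
        (deriv fun v : ℝ => Lame.LS ρ α h ((Lame.sn ρ v : ℂ) ^ 2)) u ∧
      deriv (deriv fun v : ℝ => Lame.LS ρ α h ((Lame.sn ρ v : ℂ) ^ 2)) u =
        ((α : ℂ) * ((α : ℂ) + 1) * (ρ : ℂ) ^ 2 * (Lame.sn ρ u : ℂ) ^ 2 - (h : ℂ)) *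
          Lame.LS ρ α h ((Lame.sn ρ u : ℂ) ^ 2)) := by
  obtain ⟨hpoch, hsum, hbracket, hzero, hLS, hlame, hweierstrass⟩ := mainTheorem4_general ρ α h hh
  exact ⟨hpoch, hsum, hbracket, hzero, hLS, hlame hρ0.ne',
    hweierstrass (abs_lt.2 ⟨by linarith, hρ1⟩)⟩
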